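/- Let $w_1, w_2, \dots$ be integers with $w_n > 1$ for all $n \ge 1$, let $S^1 = \{z \in \mathbb{C} : |z| = 1\}$, and let $$\Theta = \Big\{(x_0, x_1, x_2, \dots) \in \prod_{n=0}^\infty S^1 \;:\; x_{n-1} = x_n^{w_n} \text{ for all } n \ge 1\Big\},$$ with the subspace topology of the product topology, be the solenoid of type $(w_1, w_2, \dots)$. Let $r \ge 1$ be an integer. Then there exist a connected topological space $X$ and an $r$-fold covering map $X \to \Theta$ (a covering map each of whose fibres has exactly $r$ points) if and only if $r$ is relatively prime to $w_n$ for all but finitely many indices $n$. -/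

import Mathlib

universe u

/-- The solenoid of type `(w_1, w_2, …)`: the inverse limit of the circles `S¹` under the power maps
`φ_n : x ↦ x ^ w_n` (`n ≥ 1`), as a subgroup of `∏_{n ≥ 0} S¹`, with the subspace topology of the
product topology. The integer `w_{n+1}` is written `w n`, so that the compatibility condition
`x_{n-1} = φ_n (x_n)`, `n ≥ 1`, reads `x n = x (n + 1) ^ w n`, `n ≥ 0`. -/
def solenoid (w : ℕ → ℕ) : Subgroup (ℕ → Circle) where
  carrier := {x | ∀ n, x n = x (n + 1) ^ w n}
  one_mem' := fun n => by simp
  mul_mem' := fun {x y} hx hy n => by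
    simp only [Pi.mul_apply, mul_pow]
    rw [← hx n, ← hy n]
  inv_mem' := fun {x} hx n => by
    simp only [Pi.inv_apply, inv_pow]
    rw [← hx n]

/-- `p` is an `r`-fold covering map: a covering map each of whose fibres has exactly `r` points. -/
def IsFoldCovering {X Y : Type*} [TopologicalSpace X] [TopologicalSpace Y]
    (r : ℕ) (p : X → Y) : Prop :=
  IsCoveringMap p ∧ ∀ y : Y, (p ⁻¹' {y}).encard = r

/-!
Write `Θ` for the solenoid, `K n` (`solenoid.level w n`) for the closed subgroup of the points whose
first coordinates, up to the index `n`, are `1`, and `W n = w 0 * ⋯ * w (n - 1)`. The `K n` form a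
shrinking family of compact subgroups which enter every neighbourhood of `1`, and `Θ` carries the
flow by translations along a dense one-parameter subgroup `ℝ → Θ`. A point of
`K n` returns to `K n` exactly at the multiples of the time `W n`, and every leaf meets `K n`.

If `r` is coprime to `w n` for all `n ≥ N`, the `r`-th power map `Θ → Θ` is an `r`-fold covering of
`Θ` by itself: an `r`-th root of the `N`-th coordinate of a point determines a unique `r`-th root of
the point (`solenoid.exists_pow_eq`, `solenoid.eq_one_of_pow_eq_one`), so the power map is
surjective with a kernel of order `r`. The solenoid is connected since one leaf is dense.

Conversely, let `p : X → Θ` be an `r`-fold covering with `X` connected. The flow of `Θ` lifts to `X`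
(`IsCoveringMap.exists_flow_lift`), and the time `W n` map of the lift sends `p ⁻¹' K n` to itself.
For `n` large, `K n` lies in an evenly covered neighbourhood of `1`, so that `p ⁻¹' K n` is a product
of `K n` with a set of `r` sheets. By compactness there is a level `M` at which the return map
permutes the sheets by one permutation `σ`, independent of the base point
(`solenoid.exists_perm_returnMap`). For `n ≥ M` the return map to `p ⁻¹' K n` then induces
`σ ^ (W n / W M)`, and this power is transitive because an invariant set of sheets flows out to a
clopen subset of `X` (`solenoid.isCycleOn_univ_of_returnMap`). Comparing the levels `n` and `n + 1`,
a transitive permutation of `r` points has a transitive `w n`-th power, which forces `r` and `w n`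
to be coprime (`Equiv.Perm.IsCycleOn.coprime_of_pow`).
-/

open Filter Topology Set

namespace solenoid

variable {w : ℕ → ℕ}

/-! ### Coordinates of the solenoid -/

theorem apply_eq_pow (x : solenoid w) (n : ℕ) : x.1 n = x.1 (n + 1) ^ w n := x.2 n

theorem apply_eq_apply_of_le {x y : solenoid w} {m n : ℕ} (hmn : m ≤ n) (h : x.1 n = y.1 n) :
    x.1 m = y.1 m := by
  induction n, hmn using Nat.le_induction with
  | base => exact h
  | succ n _ ih => exact ih (by rw [apply_eq_pow, h, ← apply_eq_pow])

theorem continuous_apply (n : ℕ) : Continuous fun x : solenoid w => x.1 n :=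
  (_root_.continuous_apply n).comp continuous_subtype_val

theorem isClosed_coe (w : ℕ → ℕ) : IsClosed (solenoid w : Set (ℕ → Circle)) := by
  have : (solenoid w : Set (ℕ → Circle)) = ⋂ n, {x | x n = x (n + 1) ^ w n} := by
    ext x; simp [solenoid]
  rw [this]
  exact isClosed_iInter fun n => isClosed_eq (by fun_prop) (by fun_prop)

instance : CompactSpace (solenoid w) := isCompact_iff_compactSpace.1 (isClosed_coe w).isCompact

/-- A coherent sequence given from the index `N` on extends to a point of the solenoid. -/
theorem exists_apply_add_eq (N : ℕ) (u : ℕ → Circle) (hu : ∀ j, u j = u (j + 1) ^ w (N + j)) :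
    ∃ x : solenoid w, ∀ j, x.1 (N + j) = u j := by
  induction N generalizing u with
  | zero => exact ⟨⟨u, fun n => by simpa using hu n⟩, fun j => by simp⟩
  | succ N ih =>
    obtain ⟨x, hx⟩ := ih (fun j => Nat.casesOn j (u 0 ^ w N) u) fun j => by
      cases j with
      | zero => rfl
      | succ j => simpa [Nat.add_right_comm, Nat.add_assoc] using hu j
    exact ⟨x, fun j => by simpa [Nat.add_right_comm, Nat.add_assoc] using hx (j + 1)⟩

/-! ### The neighbourhoods of the identity and the one-parameter subgroup -/

/-- The closed subgroup of the points whose `n`-th coordinate, hence every coordinate of index at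
most `n`, is `1`. -/
def level (w : ℕ → ℕ) (n : ℕ) : Subgroup (solenoid w) where
  carrier := {x | x.1 n = 1}
  one_mem' := rfl
  mul_mem' {x y} hx hy := by
    change x.1 n * y.1 n = 1
    rw [show x.1 n = 1 from hx, show y.1 n = 1 from hy, one_mul]
  inv_mem' {x} hx := by
    change (x.1 n)⁻¹ = 1
    rw [show x.1 n = 1 from hx, inv_one]

theorem mem_level {n : ℕ} {x : solenoid w} : x ∈ level w n ↔ x.1 n = 1 := Iff.rfl

theorem level_anti {m n : ℕ} (h : m ≤ n) : level w n ≤ level w m := fun _ hx =>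
  apply_eq_apply_of_le (y := 1) h hx

theorem isClosed_level (n : ℕ) : IsClosed (level w n : Set (solenoid w)) :=
  isClosed_eq (continuous_apply n) continuous_const

theorem exists_level_subset {U : Set (solenoid w)} (hU : U ∈ 𝓝 1) :
    ∃ n, (level w n : Set (solenoid w)) ⊆ U := by
  obtain ⟨V, hV, hVU⟩ := mem_nhds_subtype _ _ _ |>.1 hU
  rw [nhds_pi, Filter.mem_pi] at hV
  obtain ⟨I, hI, t, ht, htV⟩ := hV
  obtain ⟨n, hn⟩ := hI.bddAbove
  refine ⟨n, fun x hx => hVU (htV fun i hi => ?_)⟩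
  have : x.1 i = 1 := level_anti (hn hi) hx
  rw [this]
  exact mem_of_mem_nhds (ht i)

/-- The degree `w 0 * ⋯ * w (n - 1)` of the bonding map from the `n`-th circle to the `0`-th. -/
def bondingDegree (w : ℕ → ℕ) (n : ℕ) : ℕ := ∏ i ∈ Finset.range n, w i

theorem bondingDegree_succ (n : ℕ) : bondingDegree w (n + 1) = bondingDegree w n * w n :=
  Finset.prod_range_succ _ _

theorem bondingDegree_dvd {m n : ℕ} (h : m ≤ n) : bondingDegree w m ∣ bondingDegree w n :=
  Finset.prod_dvd_prod_of_subset _ _ _ (by simpa using h)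

theorem bondingDegree_pos (hw : ∀ n, 1 < w n) (n : ℕ) : 0 < bondingDegree w n :=
  Finset.prod_pos fun i _ => (zero_lt_one.trans (hw i))

/-- The one-parameter subgroup `ℝ → Θ` through the identity, whose `n`-th coordinate is
`s ↦ exp (2πis / (w 0 ⋯ w (n - 1)))`. -/
noncomputable def leaf (hw : ∀ n, 1 < w n) (s : ℝ) : solenoid w :=
  ⟨fun n => Circle.exp (2 * Real.pi * (s / bondingDegree w n)), fun n => by
    rw [← Circle.exp_natCast_mul, bondingDegree_succ]
    have := bondingDegree_pos hw n
    have := zero_lt_one.trans (hw n)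
    push_cast
    field_simp⟩

variable (hw : ∀ n, 1 < w n)

theorem leaf_apply (s : ℝ) (n : ℕ) :
    (leaf hw s).1 n = Circle.exp (2 * Real.pi * (s / bondingDegree w n)) := rfl

theorem leaf_zero : leaf hw 0 = 1 := by
  ext n; simp [leaf_apply]

theorem leaf_add (s t : ℝ) : leaf hw (s + t) = leaf hw s * leaf hw t := by
  ext n
  change _ = (((leaf hw s).1 n * (leaf hw t).1 n : Circle) : ℂ)
  rw [leaf_apply, leaf_apply, leaf_apply, ← Circle.exp_add]
  congr 2; ring

theorem continuous_leaf : Continuous (leaf hw) := by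
  refine Continuous.subtype_mk (continuous_pi fun n => ?_) _
  fun_prop

theorem leaf_mem_level_iff {s : ℝ} {n : ℕ} :
    leaf hw s ∈ level w n ↔ ∃ j : ℤ, s = j * bondingDegree w n := by
  have hW : (bondingDegree w n : ℝ) ≠ 0 := by exact_mod_cast (bondingDegree_pos hw n).ne'
  rw [mem_level, leaf_apply, Circle.exp_eq_one]
  refine exists_congr fun j => ⟨fun h => ?_, fun h => ?_⟩
  · rw [mul_comm, mul_left_inj' Real.two_pi_pos.ne', div_eq_iff hW] at h
    exact h
  · rw [h]; field_simp

/-- Every point is moved into `level w n` by flowing back along its leaf for a time between `0` and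
`w 0 * ⋯ * w (n - 1)`. -/
theorem exists_leaf_neg_mul_mem_level (n : ℕ) (x : solenoid w) :
    ∃ s ∈ Icc (0 : ℝ) (bondingDegree w n), leaf hw (-s) * x ∈ level w n := by
  have hW : (0 : ℝ) < bondingDegree w n := by exact_mod_cast bondingDegree_pos hw n
  obtain ⟨θ, hθ⟩ := Circle.exp_surjective (x.1 n)
  set t := θ / (2 * Real.pi) with ht
  have h2 := Real.two_pi_pos
  -- The time `t * bondingDegree w n` has the required effect, and subtracting whole
  -- multiples of `bondingDegree w n` from it does not change the `n`-th coordinate.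
  refine ⟨Int.fract t * bondingDegree w n, ⟨mul_nonneg (Int.fract_nonneg _) hW.le,
    mul_le_of_le_one_left hW.le (Int.fract_lt_one _).le⟩, ?_⟩
  change (leaf hw _).1 n * x.1 n = 1
  rw [leaf_apply, ← hθ, ← Circle.exp_add, Circle.exp_eq_one]
  refine ⟨⌊t⌋, ?_⟩
  have : θ = t * (2 * Real.pi) := by rw [ht]; field_simp
  rw [this, neg_div, mul_div_assoc, div_self hW.ne', ← Int.self_sub_floor]
  ring

theorem denseRange_leaf : DenseRange (leaf hw) := fun x => by
  refine mem_closure_iff_nhds.2 fun U hU => ?_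
  obtain ⟨n, hn⟩ := exists_level_subset (w := w) (U := (x * ·) ⁻¹' U)
    ((continuous_const_mul x).continuousAt.preimage_mem_nhds (by simpa using hU))
  obtain ⟨s, -, hs⟩ := exists_leaf_neg_mul_mem_level hw n x
  have h : leaf hw (-s) * leaf hw s = 1 := by rw [← leaf_add, neg_add_cancel, leaf_zero]
  refine ⟨leaf hw s, ?_, mem_range_self _⟩
  have := hn ((level w n).inv_mem hs)
  rwa [mem_preimage, mul_inv, mul_inv_cancel_comm_assoc, inv_eq_of_mul_eq_one_right h] at this

theorem connectedSpace (hw : ∀ n, 1 < w n) : ConnectedSpace (solenoid w) :=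
  { (denseRange_leaf hw).preconnectedSpace (continuous_leaf hw) with toNonempty := ⟨1⟩ }

/-! ### The power maps -/

/-- If `r` is coprime to the exponents from the index `N` on, then an `r`-th root of the `N`-th
coordinate of a point extends to an `r`-th root of the point: when `a * r + b * w n = 1`, the next
coordinate of the root is the product of the `a`-th power of the next coordinate of the point and
the `b`-th power of the current coordinate of the root. -/
theorem exists_pow_eq {r N : ℕ} (hN : ∀ n, N ≤ n → r.Coprime (w n)) (y : solenoid w) {z : Circle}
    (hz : z ^ r = y.1 N) : ∃ x : solenoid w, x ^ r = y ∧ x.1 N = z := by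
  have step : ∀ j (z : {z : Circle // z ^ r = y.1 (N + j)}),
      ∃ z' : {z : Circle // z ^ r = y.1 (N + (j + 1))}, z.1 = z'.1 ^ w (N + j) := by
    rintro j ⟨z, hz⟩
    obtain ⟨a, b, hab⟩ := Nat.isCoprime_iff_coprime.2 (hN (N + j) (Nat.le_add_right _ _))
    have hy : y.1 (N + (j + 1)) ^ w (N + j) = y.1 (N + j) := (apply_eq_pow y (N + j)).symm
    set v := y.1 (N + (j + 1))
    refine ⟨⟨v ^ a * z ^ b, ?_⟩, ?_⟩
    · rw [mul_pow, ← zpow_natCast (z ^ b), zpow_comm, zpow_natCast z, hz, ← hy, ← zpow_natCast,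
        ← zpow_natCast, ← zpow_mul, ← zpow_mul, ← zpow_add, mul_comm (_ : ℤ) b, hab, zpow_one]
    · change z = (v ^ a * z ^ b) ^ w (N + j)
      rw [mul_pow, ← zpow_natCast (v ^ a), zpow_comm, zpow_natCast v, hy, ← hz, ← zpow_natCast,
        ← zpow_natCast, ← zpow_mul, ← zpow_mul, ← zpow_add, mul_comm (_ : ℤ) a, hab, zpow_one]
  choose f hf using step
  let u : ∀ j, {z : Circle // z ^ r = y.1 (N + j)} := fun j => Nat.rec ⟨z, hz⟩ f j
  obtain ⟨x, hx⟩ := exists_apply_add_eq N (fun j => (u j).1) fun j => hf j (u j)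
  refine ⟨x, Subtype.ext (funext fun n => ?_), hx 0⟩
  refine apply_eq_apply_of_le (Nat.le_add_left n N) ?_
  change x.1 (N + n) ^ r = _
  rw [hx]
  exact (u n).2

theorem pow_surjective {r N : ℕ} (hr : 1 ≤ r) (hN : ∀ n, N ≤ n → r.Coprime (w n)) :
    Function.Surjective fun x : solenoid w => x ^ r := fun y => by
  obtain ⟨θ, hθ⟩ := Circle.exp_surjective (y.1 N)
  have hr' : (r : ℝ) ≠ 0 := by positivity
  obtain ⟨x, hx, -⟩ := exists_pow_eq hN y (z := Circle.exp (θ / r))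
    (by rw [← Circle.exp_natCast_mul, mul_div_cancel₀ _ hr', hθ])
  exact ⟨x, hx⟩

theorem eq_one_of_pow_eq_one {r N : ℕ} (hN : ∀ n, N ≤ n → r.Coprime (w n)) {x : solenoid w}
    (hx : x ^ r = 1) (h : x.1 N = 1) : x = 1 := by
  have key : ∀ j, x.1 (N + j) = 1 := fun j => by
    induction j with
    | zero => exact h
    | succ j ih =>
      have h1 : x.1 (N + j + 1) ^ w (N + j) = 1 := by rw [← apply_eq_pow, ih]
      have h2 : x.1 (N + j + 1) ^ r = 1 := congrFun (congrArg Subtype.val hx) _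
      have := pow_gcd_eq_one.2 ⟨h2, h1⟩
      rwa [hN _ (Nat.le_add_right _ _), pow_one] at this
  exact Subtype.ext (funext fun n => apply_eq_apply_of_le (y := 1) (Nat.le_add_left n N) (key n))

theorem encard_pow_eq_one {r N : ℕ} (hr : 1 ≤ r) (hN : ∀ n, N ≤ n → r.Coprime (w n)) :
    {x : solenoid w | x ^ r = 1}.encard = r := by
  have hinj : InjOn (fun x : solenoid w => x.1 N) {x | x ^ r = 1} := fun x hx y hy hxy => by
    rw [mem_ofPred_eq] at hx hy
    refine div_eq_one.1 (eq_one_of_pow_eq_one hN (x := x / y) (by rw [div_pow, hx, hy, div_one]) ?_)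
    change x.1 N / y.1 N = 1
    exact div_eq_one.2 hxy
  have himage : (fun x : solenoid w => x.1 N) '' {x | x ^ r = 1} = {z : Circle | z ^ r = 1} := by
    ext z
    constructor
    · rintro ⟨x, hx, rfl⟩
      exact congrFun (congrArg Subtype.val hx) N
    · intro hz
      obtain ⟨x, hx, hxz⟩ := exists_pow_eq hN 1 (z := z) hz
      exact ⟨x, hx, hxz⟩
  have : NeZero r := ⟨by lia⟩
  have hroots : Nat.card {z : Circle | z ^ r = 1} = r := by
    conv_rhs => rw [← Complex.card_rootsOfUnity r, ← Nat.card_congr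
      (rootsOfUnityCircleEquiv r).toEquiv]
    exact Nat.card_congr ⟨fun z => rootsOfUnity.mkOfPowEq z.1 z.2,
      fun u => ⟨u.1, by simpa using congrArg Units.val u.2⟩,
      fun z => by simp, fun u => by ext; simp⟩
  rw [← hinj.encard_image, himage]
  have hfin : {z : Circle | z ^ r = 1}.Finite := Nat.finite_of_card_ne_zero (by rw [hroots]; lia)
  rw [← hfin.cast_ncard_eq]
  exact_mod_cast hroots

/-- If `r` is coprime to almost all exponents, the `r`-th power map of the solenoid is an `r`-fold
covering. -/
theorem isFoldCovering_pow {r N : ℕ} (hr : 1 ≤ r) (hN : ∀ n, N ≤ n → r.Coprime (w n)) :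
    IsFoldCovering r fun x : solenoid w => x ^ r := by
  have hker := encard_pow_eq_one hr hN
  have hsurj := pow_surjective hr hN
  constructor
  · let f : solenoid w →* solenoid w := powMonoidHom r
    have hcont : Continuous f := continuous_pow r
    have hf : IsQuotientMap f := hcont.isClosedMap.isQuotientMap hcont hsurj
    have hfin : (f.ker : Set (solenoid w)).Finite :=
      finite_of_encard_eq_coe (s := (f.ker : Set (solenoid w))) hker
    exact (hf.isQuotientCoveringMap_of_isDiscrete_ker_monoidHom hfin.isDiscrete).isCoveringMap
  · intro y
    obtain ⟨a, rfl⟩ := hsurj y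
    rw [← hker, ← (mul_right_injective a).encard_image {x | x ^ r = 1}]
    congr 1
    ext x
    simp only [mem_preimage, mem_singleton_iff, mem_image, mem_ofPred_eq]
    constructor
    · intro h
      exact ⟨a⁻¹ * x, by rw [mul_pow, h, ← mul_pow, inv_mul_cancel, one_pow], mul_inv_cancel_left _ _⟩
    · rintro ⟨t, h, hx⟩
      rw [← hx, mul_pow, h, mul_one]

end solenoid

/-! ### Lifting a flow to a covering space -/

/-- A flow on the base of a covering map lifts to the total space: lift the homotopy
`(t, (s, x)) ↦ φ (t * s) (p x)` and evaluate at `t = 1`. -/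
theorem IsCoveringMap.exists_flow_lift {X Y : Type*} [TopologicalSpace X] [TopologicalSpace Y]
    {p : X → Y} (hp : IsCoveringMap p) (φ : Flow ℝ Y) :
    ∃ T : Flow ℝ X, ∀ s x, p (T s x) = φ s (p x) := by
  have hpc := hp.continuous
  let H : C(unitInterval × (ℝ × X), Y) :=
    ⟨fun a => φ (a.1 * a.2.1) (p a.2.2), φ.continuous (by fun_prop) (by fun_prop)⟩
  let f : C(ℝ × X, X) := ⟨Prod.snd, continuous_snd⟩
  have H_0 : ∀ a, H (0, a) = p (f a) := fun a => by simp [H, f]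
  let G := hp.liftHomotopy H f H_0
  have hG : ∀ t a, p (G (t, a)) = φ (t * a.1) (p a.2) := fun t a =>
    congrFun (hp.liftHomotopy_lifts H f H_0) (t, a)
  have hG0 : ∀ a, G (0, a) = a.2 := hp.liftHomotopy_zero H f H_0
  have hp1 : ∀ s x, p (G (1, (s, x))) = φ s (p x) := fun s x => by simp [hG]
  have hzero : ∀ x, G (1, (0, x)) = x := fun x => by
    rw [hp.const_of_comp (g := fun t => G (t, (0, x))) (by fun_prop) (by simp [hG]) 1 0, hG0]
  refine ⟨⟨fun s x => G (1, (s, x)), by fun_prop, fun s t x => ?_, hzero⟩, hp1⟩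
  refine congrFun (hp.eq_of_comp_eq (g₁ := fun s => G (1, (s + t, x)))
    (g₂ := fun s => G (1, (s, G (1, (t, x))))) (by fun_prop) (by fun_prop) ?_ 0 ?_) s
  · funext s
    simp only [Function.comp_apply, hp1, φ.map_add]
  · simp [hzero]

/-- The points that a flow carries into a closed set within a compact set of times form a closed
set. -/
theorem Flow.isClosed_setOf_exists_mem {X : Type*} [TopologicalSpace X] (T : Flow ℝ X) {K : Set ℝ}
    (hK : IsCompact K) {A : Set X} (hA : IsClosed A) : IsClosed {x | ∃ s ∈ K, T s x ∈ A} := by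
  have := isCompact_iff_compactSpace.1 hK
  have h := isClosedMap_snd_of_compactSpace (X := K) (Y := X) {a | T a.1 a.2 ∈ A}
    (hA.preimage (T.continuous (by fun_prop) (by fun_prop)))
  convert h using 1
  ext x
  simp

/-- If a permutation and its `m`-th power are both transitive, then `m` is coprime to the number of
points. -/
theorem Equiv.Perm.IsCycleOn.coprime_of_pow {F : Type*} [Finite F] [Nonempty F] {τ : Equiv.Perm F}
    {m : ℕ} (h : τ.IsCycleOn univ) (hm : (τ ^ m).IsCycleOn univ) : (Nat.card F).Coprime m := by
  classical
  have := Fintype.ofFinite F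
  obtain ⟨a⟩ := ‹Nonempty F›
  rw [← Finset.coe_univ] at h hm
  have hcard : (Finset.univ : Finset F).card = Nat.card F := by simp
  have hpos : 0 < Nat.card F := Nat.card_pos
  have hd := Nat.gcd_pos_of_pos_left m hpos
  have h1 : ((τ ^ m) ^ (Nat.card F / (Nat.card F).gcd m)) a = a := by
    rw [← pow_mul, h.pow_apply_eq (Finset.mem_univ a), hcard,
      ← Nat.mul_div_assoc _ (Nat.gcd_dvd_left _ _), mul_comm,
      Nat.mul_div_assoc _ (Nat.gcd_dvd_right _ _)]
    exact dvd_mul_right _ _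
  rw [hm.pow_apply_eq (Finset.mem_univ a), hcard] at h1
  have h2 := Nat.le_of_dvd (Nat.div_pos (Nat.gcd_le_left m hpos) hd) h1
  by_contra hne
  exact absurd h2 (not_le.2 (Nat.div_lt_self hpos (by unfold Nat.Coprime at hne; lia)))

namespace solenoid

variable {w : ℕ → ℕ} {hw : ∀ n, 1 < w n}

/-- The flow of the solenoid by translations along the one-parameter subgroup. -/
noncomputable def leafFlow (hw : ∀ n, 1 < w n) : Flow ℝ (solenoid w) where
  toFun s x := leaf hw s * x
  cont' := ((continuous_leaf hw).comp continuous_fst).mul continuous_snd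
  map_add' s t x := by rw [leaf_add, mul_assoc]
  map_zero' x := by rw [leaf_zero, one_mul]

/-! ### Return maps of the lifted flow -/

section ReturnMap

variable {X : Type*} [TopologicalSpace X] {p : X → solenoid w} {T : Flow ℝ X}

theorem flow_mem_level (hT : ∀ s x, p (T s x) = leaf hw s * p x) {m n : ℕ} (hmn : m ≤ n) (j : ℕ)
    {x : X} (hx : p x ∈ level w m) : p (T (j * bondingDegree w n) x) ∈ level w m := by
  rw [hT]
  exact mul_mem (level_anti hmn ((leaf_mem_level_iff hw).2 ⟨j, by simp⟩)) hx

theorem flow_mem_of_forall_mem {n : ℕ} {A : Set X}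
    (hA : ∀ x ∈ A, T (bondingDegree w n) x ∈ A) (j : ℕ) :
    ∀ x ∈ A, T (j * bondingDegree w n) x ∈ A := by
  induction j with
  | zero => simp
  | succ j ih =>
    intro x hx
    rw [Nat.cast_succ, add_mul, one_mul, add_comm, T.map_add]
    exact hA _ (ih x hx)

/-- If the total space is connected, the preimage of `level w n` is not the union of two disjoint
nonempty closed sets that are both invariant under the return map: their saturations under the flow
would separate the total space. -/
theorem eq_empty_of_invariant [PreconnectedSpace X]
    (hT : ∀ s x, p (T s x) = leaf hw s * p x) {n : ℕ} {A B : Set X} (hA : IsClosed A)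
    (hB : IsClosed B) (hAB : A ∪ B = p ⁻¹' level w n) (hdisj : Disjoint A B)
    (hAT : ∀ x ∈ A, T (bondingDegree w n) x ∈ A) (hBT : ∀ x ∈ B, T (bondingDegree w n) x ∈ B)
    (hne : A.Nonempty) : B = ∅ := by
  -- One period of backward flow reaches `p ⁻¹' level w n` from every point; bounding the time makes
  -- the saturation of a closed set closed.
  let S (C : Set X) : Set X :=
    {x | ∃ s ∈ Icc (-(bondingDegree w n : ℝ)) 0, T s x ∈ C}
  have hS : ∀ {C}, C ⊆ S C := fun {C} x hx => ⟨0, by simp, by simpa using hx⟩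
  have hcompl : S B = (S A)ᶜ := by
    ext x
    constructor
    · rintro ⟨t, -, ht⟩ ⟨s, -, hs⟩
      have hsl : p (T s x) ∈ level w n := hAB.le (Or.inl hs)
      have htl : p (T t x) ∈ level w n := hAB.le (Or.inr ht)
      have hst : leaf hw (s - t) ∈ level w n := by
        have := div_mem hsl htl
        rwa [hT, hT, mul_div_mul_right_eq_div, div_eq_iff_eq_mul.2] at this
        rw [← leaf_add, sub_add_cancel]
      obtain ⟨j, hj⟩ := (leaf_mem_level_iff hw).1 hst
      -- The two times differ by a multiple of the return time, so the later of the two points is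
      -- obtained from the earlier one by iterating the return map.
      obtain ⟨i, rfl | rfl⟩ := j.eq_nat_or_neg
      · have h := flow_mem_of_forall_mem hBT i _ ht
        rw [← T.map_add, show (i : ℝ) * bondingDegree w n + t = s by
          push_cast at hj; linarith] at h
        exact disjoint_left.1 hdisj hs h
      · have h := flow_mem_of_forall_mem hAT i _ hs
        rw [← T.map_add, show (i : ℝ) * bondingDegree w n + s = t by
          push_cast at hj; linarith] at h
        exact disjoint_left.1 hdisj h ht
    · intro hx
      obtain ⟨s, hs, hsx⟩ := exists_leaf_neg_mul_mem_level hw n (p x)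
      have hs' : -s ∈ Icc (-(bondingDegree w n : ℝ)) 0 := ⟨neg_le_neg hs.2, neg_nonpos.2 hs.1⟩
      rw [← hT] at hsx
      exact (hAB.ge hsx).elim (fun h => (hx ⟨-s, hs', h⟩).elim) fun h => ⟨-s, hs', h⟩
  have hclopen : IsClopen (S A) :=
    ⟨T.isClosed_setOf_exists_mem isCompact_Icc hA, by
      rw [← isClosed_compl_iff, ← hcompl]
      exact T.isClosed_setOf_exists_mem isCompact_Icc hB⟩
  rcases isClopen_iff.1 hclopen with h | h
  · exact ((hne.mono hS).ne_empty h).elim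
  · rw [h, compl_univ] at hcompl
    exact subset_empty_iff.1 (hS.trans hcompl.le)

/-- A continuous map from the compact group `level w N` to a discrete space is constant on the
cosets of a smaller subgroup of the family. -/
theorem exists_eq_of_inv_mul_mem_level {D : Type*} [TopologicalSpace D] [DiscreteTopology D] {N : ℕ}
    {g : level w N → D} (hg : Continuous g) :
    ∃ M, ∀ k k' : level w N, (k : solenoid w)⁻¹ * k' ∈ level w M → g k = g k' := by
  have : CompactSpace (level w N) := isCompact_iff_compactSpace.1 (isClosed_level N).isCompact
  have h := isCompact_univ.induction_on (p := fun S : Set (level w N) =>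
    ∃ M, ∀ k ∈ S, ∀ k' : level w N, (k : solenoid w)⁻¹ * k' ∈ level w M → g k = g k')
    ⟨0, by simp⟩ (fun S S' hS ⟨M, hM⟩ => ⟨M, fun k hk => hM k (hS hk)⟩) ?_ ?_
  · obtain ⟨M, hM⟩ := h
    exact ⟨M, fun k => hM k (mem_univ k)⟩
  · rintro S S' ⟨M, hM⟩ ⟨M', hM'⟩
    refine ⟨max M M', ?_⟩
    rintro k (hk | hk) k' hkk'
    · exact hM k hk k' (level_anti (le_max_left _ _) hkk')
    · exact hM' k hk k' (level_anti (le_max_right _ _) hkk')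
  · intro k _
    obtain ⟨V, hV, hVg⟩ := mem_nhds_subtype _ _ _ |>.1
      (hg.continuousAt.preimage_mem_nhds (mem_nhds_discrete.2 (mem_singleton (g k))))
    have hV' : ((k : solenoid w) * ·) ⁻¹' V ∈ 𝓝 (1 : solenoid w) :=
      (continuous_const_mul _).continuousAt.preimage_mem_nhds (by simpa using hV)
    -- `level w M` need not be open, so the local statement is proved on the open set `k * Z`, and
    -- `Z * Z` leaves room for a further translation by `level w M`.
    obtain ⟨Z, hZo, hZ1, hZ⟩ := exists_open_nhds_one_mul_subset hV'
    obtain ⟨M, hM⟩ := exists_level_subset (hZo.mem_nhds hZ1)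
    refine ⟨{k' | (k : solenoid w)⁻¹ * k' ∈ Z}, mem_nhdsWithin_of_mem_nhds ?_, M, ?_⟩
    · exact (hZo.preimage (by fun_prop)).mem_nhds (by simpa using hZ1)
    · intro k₁ hk₁ k₂ hk₂
      have h1 : g k₁ = g k := hVg (by
        simpa using hZ (mul_mem_mul hk₁ hZ1))
      have h2 : g k₂ = g k := hVg (by
        simpa [mul_assoc] using hZ (mul_mem_mul hk₁ (hM hk₂)))
      rw [h1, h2]

variable {F : Type*} [TopologicalSpace F] [DiscreteTopology F]

/-- In a trivialization with finite fibre over `level w N`, the permutation of the sheets effected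
by the return map depends only on the base point modulo a smaller subgroup `level w M`. -/
theorem exists_returnMap_snd_eq [Finite F] (hT : ∀ s x, p (T s x) = leaf hw s * p x)
    (e : Bundle.Trivialization F p) {N : ℕ} (hN : (level w N : Set (solenoid w)) ⊆ e.baseSet) :
    ∃ M, ∀ y y', p y ∈ level w N → p y' ∈ level w N → (p y)⁻¹ * p y' ∈ level w M →
      (e y).2 = (e y').2 →
      (e (T (bondingDegree w N) y)).2 = (e (T (bondingDegree w N) y')).2 := by
  let g : level w N → F → F := fun k f =>
    (e (T (bondingDegree w N) (e.toOpenPartialHomeomorph.symm (k, f)))).2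
  have hsrc : ∀ (k : level w N) (f : F),
      T (bondingDegree w N) (e.toOpenPartialHomeomorph.symm (k, f)) ∈ e.source := fun k f => by
    rw [e.mem_source]
    have h := flow_mem_level hT le_rfl 1 (x := e.toOpenPartialHomeomorph.symm (k, f)) (m := N)
      (by rw [e.proj_symm_apply' (hN k.2)]; exact k.2)
    exact hN (by simpa using h)
  have hg : Continuous g := by
    refine continuous_pi fun f => continuous_snd.comp ?_
    refine e.continuousOn_toFun.comp_continuous ?_ fun k => hsrc k f
    refine T.continuous continuous_const ?_
    exact e.toOpenPartialHomeomorph.continuousOn_symm.comp_continuous (by fun_prop)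
      fun k => e.mem_target.2 (hN k.2)
  obtain ⟨M, hM⟩ := exists_eq_of_inv_mul_mem_level hg
  refine ⟨M, fun y y' hy hy' hyy' hc => ?_⟩
  have h := congrFun (hM ⟨p y, hy⟩ ⟨p y', hy'⟩ hyy') (e y).2
  simp only [g] at h
  rwa [e.symm_apply_mk_proj (e.mem_source.2 (hN hy)), hc,
    e.symm_apply_mk_proj (e.mem_source.2 (hN hy'))] at h

/-- Near the identity, the return map of a finite covering permutes the sheets by a permutation `σ`
that does not depend on the base point. -/
theorem exists_perm_returnMap [Finite F] (hT : ∀ s x, p (T s x) = leaf hw s * p x)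
    (e : Bundle.Trivialization F p) {N : ℕ} (hN : (level w N : Set (solenoid w)) ⊆ e.baseSet) :
    ∃ M, N ≤ M ∧ ∃ σ : Equiv.Perm F, ∀ y, p y ∈ level w M →
      (e (T (bondingDegree w M) y)).2 = σ (e y).2 := by
  obtain ⟨M', hM'⟩ := exists_returnMap_snd_eq hT e hN
  obtain ⟨M, hNM, hM⟩ : ∃ M, N ≤ M ∧ M' ≤ M := ⟨max N M', le_max_left _ _, le_max_right _ _⟩
  -- The flow preserves the quotients `(p y)⁻¹ * p y'`, so the uniformity of the return map to
  -- `level w N` passes to its iterates, among them the return map to `level w M`.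
  have hiter : ∀ (j : ℕ) (y y'), p y ∈ level w N → p y' ∈ level w N →
      (p y)⁻¹ * p y' ∈ level w M' → (e y).2 = (e y').2 →
      (e (T (j * bondingDegree w N) y)).2 = (e (T (j * bondingDegree w N) y')).2 := by
    intro j y y' hy hy' hyy' hc
    induction j with
    | zero => simpa using hc
    | succ j ih =>
      rw [Nat.cast_succ, add_mul, one_mul, add_comm, T.map_add, T.map_add]
      refine hM' _ _ (flow_mem_level hT le_rfl j hy) (flow_mem_level hT le_rfl j hy') ?_ ih
      rwa [hT, hT, mul_inv, mul_mul_mul_comm, inv_mul_cancel, one_mul]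
  have hconst : ∀ y y', p y ∈ level w M → p y' ∈ level w M → (e y).2 = (e y').2 →
      (e (T (bondingDegree w M) y)).2 = (e (T (bondingDegree w M) y')).2 := by
    intro y y' hy hy' hc
    obtain ⟨j, hj⟩ := bondingDegree_dvd (w := w) hNM
    rw [hj, mul_comm, Nat.cast_mul]
    exact hiter j y y' (level_anti hNM hy) (level_anti hNM hy')
      (level_anti hM (mul_mem (inv_mem hy) hy')) hc
  have h1 : (1 : solenoid w) ∈ e.baseSet := hN (one_mem _)
  let s (f : F) : X := e.toOpenPartialHomeomorph.symm (1, f)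
  have hps : ∀ f, p (s f) = 1 := fun f => e.proj_symm_apply' h1
  have hes : ∀ f, (e (s f)).2 = f := fun f => by rw [e.apply_symm_apply' h1]
  have hinj : Function.Injective fun f => (e (T (bondingDegree w M) (s f))).2 := by
    intro f f' hff'
    have hp : p (T (bondingDegree w M) (s f)) = p (T (bondingDegree w M) (s f')) := by
      rw [hT, hT, hps, hps]
    have hsrc : ∀ f, T (bondingDegree w M) (s f) ∈ e.source := fun f => by
      have h := flow_mem_level hT (le_refl M) 1 (x := s f) (by rw [hps]; exact one_mem _)
      exact e.mem_source.2 (hN (level_anti hNM (by simpa using h)))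
    have heq := e.injOn (hsrc f) (hsrc f') (Prod.ext
      ((e.coe_fst (hsrc f)).trans (hp.trans (e.coe_fst (hsrc f')).symm)) hff')
    have := congrArg (T (-(bondingDegree w M : ℝ))) heq
    rw [← T.map_add, ← T.map_add, neg_add_cancel, T.map_zero_apply, T.map_zero_apply] at this
    rw [← hes f, ← hes f', this]
  refine ⟨M, hNM, Equiv.ofBijective _ (Finite.injective_iff_bijective.1 hinj), fun y hy => ?_⟩
  exact hconst y _ hy (by rw [hps]; exact one_mem _) (hes _).symm

/-- If the total space is connected, the return map to any `level w n` permutes the sheets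
transitively. -/
theorem isCycleOn_univ_of_returnMap [PreconnectedSpace X] (hp : Continuous p)
    (hT : ∀ s x, p (T s x) = leaf hw s * p x) (e : Bundle.Trivialization F p) {n : ℕ}
    (hn : (level w n : Set (solenoid w)) ⊆ e.baseSet) {τ : Equiv.Perm F}
    (hτ : ∀ y, p y ∈ level w n → (e (T (bondingDegree w n) y)).2 = τ (e y).2) :
    τ.IsCycleOn univ := by
  refine ⟨τ.bijective.bijOn_univ, fun a _ b _ => ?_⟩
  have h1 : (1 : solenoid w) ∈ e.baseSet := hn (one_mem _)
  have hlevel : ∀ f, e.toOpenPartialHomeomorph.symm (1, f) ∈ p ⁻¹' level w n := fun f => by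
    rw [mem_preimage, e.proj_symm_apply' h1]; exact one_mem _
  have hes : ∀ f, (e (e.toOpenPartialHomeomorph.symm (1, f))).2 = f := fun f => by
    rw [e.apply_symm_apply' h1]
  let A (O : Set F) : Set X := p ⁻¹' level w n ∩ (fun y => (e y).2) ⁻¹' O
  have hcont : ContinuousOn (fun y => (e y).2) (p ⁻¹' level w n) :=
    continuous_snd.comp_continuousOn
      (e.continuousOn_toFun.mono fun y hy => e.mem_source.2 (hn hy))
  have hA : ∀ O, IsClosed (A O) := fun O =>
    hcont.preimage_isClosed_of_isClosed ((isClosed_level n).preimage hp) (isClosed_discrete O)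
  have hAT : ∀ O : Set F, (∀ f ∈ O, τ f ∈ O) → ∀ x ∈ A O, T (bondingDegree w n) x ∈ A O := by
    rintro O hO x ⟨hx, hxO⟩
    refine ⟨by simpa using flow_mem_level hT le_rfl 1 hx, ?_⟩
    rw [mem_preimage, hτ x hx]
    exact hO _ hxO
  let O : Set F := {f | τ.SameCycle a f}
  have hempty := eq_empty_of_invariant hT (hA O) (hA Oᶜ)
    (by rw [← inter_union_distrib_left, ← preimage_union, union_compl_self, preimage_univ,
      inter_univ])
    (disjoint_left.2 fun x hx hx' => hx'.2 hx.2)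
    (hAT O fun f hf => Equiv.Perm.sameCycle_apply_right.2 hf)
    (hAT Oᶜ fun f hf h => hf (Equiv.Perm.sameCycle_apply_right.1 h))
    ⟨_, hlevel a, by rw [mem_preimage, hes]; exact Equiv.Perm.SameCycle.refl τ a⟩
  by_contra hab
  exact (hempty.le ⟨hlevel b, by rw [mem_preimage, hes]; exact hab⟩ : _ ∈ (∅ : Set X))

end ReturnMap

/-- The number of sheets of a connected finite covering of the solenoid is coprime to almost all
exponents. -/
theorem exists_forall_coprime (hw : ∀ n, 1 < w n) {X : Type*} [TopologicalSpace X]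
    [PreconnectedSpace X] {p : X → solenoid w} {r : ℕ} (hr : 1 ≤ r) (hp : IsFoldCovering r p) :
    ∃ M, ∀ n, M ≤ n → r.Coprime (w n) := by
  obtain ⟨hcov, hfib⟩ := hp
  have hfin : (p ⁻¹' {1}).Finite := finite_of_encard_eq_coe (hfib 1)
  have hcard : Nat.card (p ⁻¹' {1}) = r := by
    rw [Nat.card_coe_set_eq, ncard, hfib 1, ENat.toNat_natCast]
  have : Finite (p ⁻¹' {1}) := hfin
  have : Nonempty (p ⁻¹' {1}) := (Nat.card_pos_iff.1 (by lia)).1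
  have := (hcov 1).discreteTopology_fiber
  let e := (hcov 1).toTrivialization
  obtain ⟨N, hN⟩ := exists_level_subset
    (e.open_baseSet.mem_nhds (hcov 1).mem_toTrivialization_baseSet)
  obtain ⟨T, hT⟩ := hcov.exists_flow_lift (leafFlow hw)
  obtain ⟨M, hNM, σ, hσ⟩ := exists_perm_returnMap (hw := hw) hT e hN
  have hpow : ∀ (j : ℕ) (y), p y ∈ level w M →
      (e (T (j * bondingDegree w M) y)).2 = (σ ^ j) (e y).2 := by
    intro j y hy
    induction j with
    | zero => simp
    | succ j ih =>
      rw [Nat.cast_succ, add_mul, one_mul, add_comm, T.map_add,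
        hσ _ (flow_mem_level (hw := hw) hT le_rfl j hy), ih, pow_succ', Equiv.Perm.mul_apply]
  have hcyc : ∀ n, M ≤ n → ∀ j, bondingDegree w n = bondingDegree w M * j →
      (σ ^ j).IsCycleOn univ := by
    intro n hn j hj
    refine isCycleOn_univ_of_returnMap (hw := hw) hcov.continuous hT e
      (Subset.trans (level_anti (hNM.trans hn)) hN) fun y hy => ?_
    rw [hj, mul_comm, Nat.cast_mul, hpow j y (level_anti hn hy)]
  refine ⟨M, fun n hn => ?_⟩
  obtain ⟨j, hj⟩ := bondingDegree_dvd (w := w) hn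
  rw [← hcard]
  refine (hcyc n hn j hj).coprime_of_pow ?_
  rw [← pow_mul]
  exact hcyc (n + 1) (by lia) _ (by rw [bondingDegree_succ, hj, mul_assoc])

end solenoid

theorem mainTheorem3 (w : ℕ → ℕ) (hw : ∀ n, 1 < w n) (r : ℕ) (hr : 1 ≤ r) :
    (∃ (X : Type u) (_ : TopologicalSpace X) (p : X → solenoid w),
        ConnectedSpace X ∧ IsFoldCovering r p) ↔
      {n : ℕ | ¬ Nat.Coprime r (w n)}.Finite := by
  constructor
  · rintro ⟨X, _, p, _, hp⟩
    obtain ⟨M, hM⟩ := solenoid.exists_forall_coprime hw hr hp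
    exact (finite_lt_nat M).subset fun n hn => not_le.1 fun h => hn (hM n h)
  · intro hfin
    obtain ⟨N, hN⟩ := hfin.bddAbove
    obtain ⟨hcov, hfib⟩ := solenoid.isFoldCovering_pow (w := w) (N := N + 1) hr fun n hn => by
      by_contra h
      have := hN h
      lia
    have := solenoid.connectedSpace hw
    refine ⟨ULift.{u} (solenoid w), inferInstance, _,
      Homeomorph.ulift.symm.surjective.connectedSpace Homeomorph.ulift.symm.continuous,
      hcov.comp_homeomorph Homeomorph.ulift, fun y => ?_⟩
    rw [preimage_comp, ← hfib y]
    exact encard_preimage_of_bijective Homeomorph.ulift.bijective _
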